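/- Let $D,n\ge 0$ be integers, $\beta\in\mathbb{R}^D$ and $\sigma>0$. Let $x$ be a standard normal random vector in $\mathbb{R}^D$, let $\varepsilon$ be a standard normal random variable independent of $x$, and let $y=x^{\mathsf T}\beta+\sigma\varepsilon$. Let $(x^{(1)},y^{(1)}),\dots,(x^{(n)},y^{(n)})$ be i.i.d. copies of $(x,y)$, independent of $(x,y)$, and put $\mathbf{y}=(y^{(1)},\dots,y^{(n)})$. Let $p\in\{0,\dots,D\}$ and let $T\subseteq\{1,\dots,D\}$ be any set of cardinality $p$, with complement $T^c$. For $v\in\mathbb{R}^D$ and $A\subseteq\{1,\dots,D\}$ write $v_A=(v_j)_{j\in A}$, and let $X_T$ be the $n\times p$ matrix whose $i$-th row is $x^{(i)}_T$. Define $\hat\beta\in\mathbb{R}^D$ by $\hat\beta_T=X_T^{\dagger}\mathbf{y}$ and $\hat\beta_{T^c}=0$, where $\dagger$ denotes the Moore–Penrose pseudoinverse. Then, with $\|\cdot\|$ the Euclidean norm, and with the expectation (taken in $[0,+\infty]$) over the sample and $(x,y)$, $$ \mathbb{E}\big[(y-x^{\mathsf T}\hat\beta)^2\big]= \begin{cases}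 (\|\beta_{T^c}\|^2+\sigma^2)\left(1+\dfrac{p}{n-1-p}\right) & \text{if } p\le n-2,\\[2mm] +\infty & \text{if } n-1\le p\le n+1,\ n\ge 1 \text{ and } p\ge 1,\\[2mm] \|\beta_T\|^2\left(1-\dfrac{n}{p}\right)+(\|\beta_{T^c}\|^2+\sigma^2)\left(1+\dfrac{n}{p-n-1}\right) & \text{if } p\ge n+2. \end{cases} $$ -/

import Mathlib

open MeasureTheory ProbabilityTheory
open scoped Matrix ENNReal

namespace DoubleDescent

/-- `B` is a Moore-Penrose pseudoinverse of the real matrix `A`: the four Penrose equations. -/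
structure IsMoorePenrose {m n : Type*} [Fintype m] [Fintype n]
    (A : Matrix m n ℝ) (B : Matrix n m ℝ) : Prop where
  mul_mul_left : A * B * A = A
  mul_mul_right : B * A * B = B
  symm_left : (A * B)ᵀ = A * B
  symm_right : (B * A)ᵀ = B * A

/-- The Moore-Penrose pseudoinverse is unique. -/
theorem IsMoorePenrose.unique {m n : Type*} [Fintype m] [Fintype n]
    {A : Matrix m n ℝ} {B C : Matrix n m ℝ}
    (hB : IsMoorePenrose A B) (hC : IsMoorePenrose A C) : B = C := by
  have h1 : A * B = A * C := by
    calc A * B = (A * C * A) * B := by rw [hC.mul_mul_left]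
      _ = (A * C) * (A * B) := by simp only [Matrix.mul_assoc]
      _ = (A * C)ᵀ * (A * B)ᵀ := by rw [hC.symm_left, hB.symm_left]
      _ = ((A * B * A) * C)ᵀ := by
        rw [← Matrix.transpose_mul]; simp only [Matrix.mul_assoc]
      _ = A * C := by rw [hB.mul_mul_left, hC.symm_left]
  have h2 : B * A = C * A := by
    calc B * A = B * (A * C * A) := by rw [hC.mul_mul_left]
      _ = (B * A) * (C * A) := by simp only [Matrix.mul_assoc]
      _ = (B * A)ᵀ * (C * A)ᵀ := by rw [hC.symm_right, hB.symm_right]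
      _ = (C * (A * B * A))ᵀ := by
        rw [← Matrix.transpose_mul]; simp only [Matrix.mul_assoc]
      _ = C * A := by rw [hB.mul_mul_left, hC.symm_right]
  calc B = B * A * B := hB.mul_mul_right.symm
    _ = C * A * B := by rw [h2]
    _ = C * A * C := by rw [Matrix.mul_assoc, h1, ← Matrix.mul_assoc]
    _ = C := hC.mul_mul_right

/-- Every real matrix has a Moore-Penrose pseudoinverse. -/
theorem exists_isMoorePenrose {m n : Type*} [Fintype m] [Fintype n]
    (A : Matrix m n ℝ) : ∃ B : Matrix n m ℝ, IsMoorePenrose A B := by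
  classical
  have hG : (Aᵀ * A).IsHermitian := by
    simpa using Matrix.isHermitian_conjTranspose_mul_self A
  obtain ⟨H, hHs, hc, h1, h2⟩ : ∃ H : Matrix n n ℝ, Hᵀ = H ∧ H * (Aᵀ * A) = (Aᵀ * A) * H ∧
      (Aᵀ * A) * H * (Aᵀ * A) = Aᵀ * A ∧ H * (Aᵀ * A) * H = H := by
    obtain ⟨U, V, d, hUV, hVU, hVt, hd⟩ : ∃ (U V : Matrix n n ℝ) (d : n → ℝ), V * U = 1 ∧
        U * V = 1 ∧ Uᵀ = V ∧ Aᵀ * A = U * Matrix.diagonal d * V := by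
      refine ⟨hG.eigenvectorUnitary, star (hG.eigenvectorUnitary : Matrix n n ℝ),
        hG.eigenvalues, ?_, ?_, ?_, ?_⟩
      · exact Unitary.coe_star_mul_self _
      · exact Unitary.coe_mul_star_self _
      · rw [Matrix.star_eq_conjTranspose, Matrix.conjTranspose_eq_transpose_of_trivial]
      · have := hG.spectral_theorem
        rw [Unitary.conjStarAlgAut_apply] at this
        simpa using this
    have key : ∀ e f : n → ℝ, (U * Matrix.diagonal e * V) * (U * Matrix.diagonal f * V) =
        U * Matrix.diagonal (fun i => e i * f i) * V := by
      intro e f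
      calc (U * Matrix.diagonal e * V) * (U * Matrix.diagonal f * V)
          = U * Matrix.diagonal e * (V * U) * Matrix.diagonal f * V := by
            simp only [Matrix.mul_assoc]
        _ = _ := by
            rw [hUV, Matrix.mul_one, Matrix.mul_assoc U, Matrix.diagonal_mul_diagonal]
    have hVU' : Vᵀ = U := by rw [← hVt, Matrix.transpose_transpose]
    refine ⟨U * Matrix.diagonal (fun i => (d i)⁻¹) * V, ?_, ?_, ?_, ?_⟩
    · simp only [Matrix.transpose_mul, Matrix.diagonal_transpose, hVU', hVt, Matrix.mul_assoc]
    · rw [hd, key, key]; simp only [mul_comm]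
    · rw [hd, key, key]; congr; ext i
      by_cases h : d i = 0 <;> simp [h]
    · rw [hd, key, key]; congr; ext i
      by_cases h : d i = 0 <;> simp [h]
  have h3 : A * H * (Aᵀ * A) = A := by
    have h0 : Aᵀ * A * (H * (Aᵀ * A) - 1) = 0 := by
      rw [Matrix.mul_sub, ← Matrix.mul_assoc, h1, Matrix.mul_one, sub_self]
    have h0' : A * (H * (Aᵀ * A) - 1) = 0 := by
      rw [← Matrix.conjTranspose_eq_transpose_of_trivial] at h0
      have := (Matrix.conjTranspose_mul_self_mul_eq_zero A _).1 h0
      simpa using this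
    rw [Matrix.mul_sub, Matrix.mul_one, sub_eq_zero] at h0'
    rw [Matrix.mul_assoc, h0']
  refine ⟨H * Aᵀ, ?_, ?_, ?_, ?_⟩
  · simpa only [Matrix.mul_assoc] using h3
  · have := congrArg (· * Aᵀ) h2
    simpa only [Matrix.mul_assoc] using this
  · simp only [Matrix.transpose_mul, Matrix.transpose_transpose, hHs, Matrix.mul_assoc]
  · rw [Matrix.mul_assoc, Matrix.transpose_mul, hHs, Matrix.transpose_mul,
      Matrix.transpose_transpose, ← hc]

/-- The Moore-Penrose pseudoinverse of a real matrix. -/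
noncomputable def pinv {m n : Type*} [Fintype m] [Fintype n] (A : Matrix m n ℝ) :
    Matrix n m ℝ :=
  (exists_isMoorePenrose A).choose

/-- `pinv A` satisfies the Penrose equations. -/
theorem pinv_isMoorePenrose {m n : Type*} [Fintype m] [Fintype n] (A : Matrix m n ℝ) :
    IsMoorePenrose A (pinv A) :=
  (exists_isMoorePenrose A).choose_spec

/-- The subvector `v_A = (v_j : j ∈ A)`, with the Euclidean norm. -/
def subvec {D : ℕ} (A : Finset (Fin D)) (v : EuclideanSpace ℝ (Fin D)) :
    EuclideanSpace ℝ A :=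
  WithLp.toLp 2 fun j : A => v j

/-- The `n × |A|` design matrix `X_A`: its `i`-th row is the subvector `x⁽ⁱ⁾_A`. -/
def design {n D : ℕ} (A : Finset (Fin D)) (X : Fin n → EuclideanSpace ℝ (Fin D)) :
    Matrix (Fin n) A ℝ :=
  Matrix.of fun i j => X i j

/-- The fitted coefficients `β̂`, given by `β̂_T = X_T† y` and `β̂_{Tᶜ} = 0`. -/
noncomputable def fit {n D : ℕ} (T : Finset (Fin D)) (X : Fin n → EuclideanSpace ℝ (Fin D))
    (y : Fin n → ℝ) : EuclideanSpace ℝ (Fin D) :=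
  WithLp.toLp 2 fun j => if h : j ∈ T then (pinv (design T X) *ᵥ y) ⟨j, h⟩ else 0

/-- The risk `E[(y - xᵀ β̂)²]`, as an extended nonnegative number, of the coefficients fitted
to the sample `(X i, Y i)`, at the point `(x, y)`. -/
noncomputable def risk {Ω : Type*} [MeasurableSpace Ω] (P : Measure Ω) {n D : ℕ}
    (T : Finset (Fin D)) (x : Ω → EuclideanSpace ℝ (Fin D)) (y : Ω → ℝ)
    (X : Fin n → Ω → EuclideanSpace ℝ (Fin D)) (Y : Fin n → Ω → ℝ) : ℝ≥0∞ :=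
  ∫⁻ ω, ENNReal.ofReal
    ((y ω - inner ℝ (x ω) (fit T (fun i => X i ω) (fun i => Y i ω))) ^ 2) ∂P

end DoubleDescent

/-!
The error of the fit splits in three. Put `s² = ‖β_{Tᶜ}‖² + σ²` and let `η` be the part of the
responses that is not explained by the selected features. Then `η` is independent of the design
matrix `X_T` and has independent `N(0, s²)` entries (`map_subvec_noise`,
`measurePreserving_sample`), and `β_T - β̂_T = (1 - X_T† X_T) β_T - X_T† η` is a sum of two
orthogonal vectors (`norm_sq_sub_pinv_mulVec`). A fresh data point adds the error of the discarded
features and of the noise (`lintegral_sq_sub_inner`), so that (`risk_eq`)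

`risk = E ‖(1 - X_T† X_T) β_T‖² + s² (1 + E ‖X_T†‖_F²)`.

*Variance.* Let `A` be a Gaussian matrix with `k ≤ m` rows in `ℝᵐ`. The rows are almost surely
linearly independent (`ae_linearIndependent_pi_stdGaussian`). The `j`-th column of `A†` is then
`r / ‖r‖²`, where `r` is the residual of the `j`-th row after projecting on the other rows
(`norm_sq_mul_norm_sq_residual`). Given the other rows, `r` is a standard Gaussian vector in a
space of dimension `m - k + 1`, and `E[1 / χ²_d]` is `1 / (d - 2)` for `d ≥ 3` and infinite for
`d ≤ 2` (`lintegral_inv_norm_sq_stdGaussian`). Hence `E ‖A†‖_F² = k / (m - k - 1)`, or `∞` when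
`m - k ≤ 1` and `k ≥ 1`. Since the law of a Gaussian matrix is invariant under transposition and
`(Aᵀ)† = (A†)ᵀ`, this covers tall matrices too.

*Bias.* `A† A` is the orthogonal projection onto the row space of `A`. For tall `A` it is almost
surely the identity. For wide `A`, the law of `A` is invariant under isometries of `ℝᵐ`, so
`E ‖(1 - A† A) v‖²` depends only on `‖v‖`; summing over an orthonormal basis gives
`‖v‖² (1 - k / m)` (`lintegral_norm_sq_bias`).

All expectations are Lebesgue integrals in `[0, ∞]`, so that the infinite case needs no separate
treatment.
-/

namespace DoubleDescent

/-! ### Standard Gaussian vectors and the reciprocal of a chi-squared variable -/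

lemma lintegral_exp_neg_mul_sq_gaussianReal {t : ℝ} (ht : 0 ≤ t) :
    ∫⁻ x, ENNReal.ofReal (Real.exp (-t * x ^ 2)) ∂gaussianReal 0 1 =
      ENNReal.ofReal ((1 + 2 * t) ^ (-(1 / 2) : ℝ)) := by
  rw [gaussianReal_of_var_ne_zero 0 one_ne_zero,
    lintegral_withDensity_eq_lintegral_mul _ (measurable_gaussianPDF 0 1) (by fun_prop)]
  have hb : (0 : ℝ) < 1 / 2 + t := by positivity
  have h1 : ∀ x : ℝ, (gaussianPDF 0 1 * fun x : ℝ => ENNReal.ofReal (Real.exp (-t * x ^ 2))) x =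
      ENNReal.ofReal ((√(2 * Real.pi))⁻¹ * Real.exp (-(1 / 2 + t) * x ^ 2)) := by
    intro x
    simp only [Pi.mul_apply, gaussianPDF, gaussianPDFReal]
    rw [← ENNReal.ofReal_mul (by positivity), mul_assoc, ← Real.exp_add]
    congr 2
    · simp
    · congr 1; simp; ring
  simp_rw [h1]
  rw [← ofReal_integral_eq_lintegral_ofReal
    ((integrable_exp_neg_mul_sq hb).const_mul _) (ae_of_all _ fun x => by positivity),
    integral_const_mul, integral_gaussian]
  congr 1
  rw [Real.rpow_neg (by positivity), ← Real.sqrt_eq_rpow, ← Real.sqrt_inv, ← Real.sqrt_inv,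
    ← Real.sqrt_mul (by positivity)]
  congr 1
  field_simp

lemma lintegral_prod_pi {ι : Type*} [Fintype ι] {α : ι → Type*} [∀ i, MeasurableSpace (α i)]
    (μ : ∀ i, Measure (α i)) [∀ i, IsProbabilityMeasure (μ i)] {f : ∀ i, α i → ℝ≥0∞}
    (hf : ∀ i, Measurable (f i)) :
    ∫⁻ x, ∏ i, f i (x i) ∂Measure.pi μ = ∏ i, ∫⁻ x, f i x ∂μ i := by
  refine (lintegral_prod_eq_prod_lintegral_of_indepFun Finset.univ (fun i (x : ∀ i, α i) => f i (x i))
    (iIndepFun_pi fun i => (hf i).aemeasurable)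
    fun i => (hf i).comp (measurable_pi_apply i)).trans ?_
  exact Finset.prod_congr rfl fun i _ =>
    (measurePreserving_eval μ i).lintegral_comp (hf i)

section InnerProductSpace

variable {E : Type*} [NormedAddCommGroup E] [InnerProductSpace ℝ E] [FiniteDimensional ℝ E]
  [MeasurableSpace E] [BorelSpace E]

/-- The Laplace transform of the chi-squared distribution with `finrank ℝ E` degrees of
freedom. -/
lemma lintegral_exp_neg_mul_norm_sq_stdGaussian {t : ℝ} (ht : 0 ≤ t) :
    ∫⁻ z : E, ENNReal.ofReal (Real.exp (-t * ‖z‖ ^ 2)) ∂stdGaussian E =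
      ENNReal.ofReal ((1 + 2 * t) ^ (-(Module.finrank ℝ E / 2) : ℝ)) := by
  have h1 : ∀ x : Fin (Module.finrank ℝ E) → ℝ,
      ENNReal.ofReal (Real.exp (-t * ‖∑ i, x i • stdOrthonormalBasis ℝ E i‖ ^ 2)) =
      ∏ i, ENNReal.ofReal (Real.exp (-t * x i ^ 2)) := by
    intro x
    rw [← ENNReal.ofReal_prod_of_nonneg fun i _ => (Real.exp_pos _).le, ← Real.exp_sum,
      ← Finset.mul_sum, ← (stdOrthonormalBasis ℝ E).sum_sq_inner_right]
    congr 5 with i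
    simp [inner_sum, inner_smul_right, orthonormal_iff_ite.1 (stdOrthonormalBasis ℝ E).orthonormal]
  rw [stdGaussian, lintegral_map (by fun_prop) (by fun_prop)]
  simp_rw [h1]
  rw [lintegral_prod_pi (fun _ => gaussianReal 0 1)
    (f := fun _ x => ENNReal.ofReal (Real.exp (-t * x ^ 2))) fun i => by fun_prop]
  simp_rw [lintegral_exp_neg_mul_sq_gaussianReal ht]
  rw [Finset.prod_const, Finset.card_univ, Fintype.card_fin, ← ENNReal.ofReal_pow (by positivity),
    ← Real.rpow_natCast, ← Real.rpow_mul (by positivity)]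
  congr 2
  ring

end InnerProductSpace

/-- The value is `⊤` for `c = 0`, in agreement with `0⁻¹ = ⊤` in `ℝ≥0∞`. -/
lemma lintegral_exp_neg_mul_Ioi (c : ℝ) (hc : 0 ≤ c) :
    ∫⁻ t in Set.Ioi (0 : ℝ), ENNReal.ofReal (Real.exp (-t * c)) = (ENNReal.ofReal c)⁻¹ := by
  rcases hc.eq_or_lt with rfl | hc
  · simp
  · have h : ∀ t : ℝ, -t * c = -c * t := fun t => by ring
    simp_rw [h]
    rw [← ofReal_integral_eq_lintegral_ofReal
      (integrableOn_exp_mul_Ioi (neg_lt_zero.2 hc) 0)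
      (ae_of_all _ fun x => by positivity),
      integral_exp_mul_Ioi (neg_lt_zero.2 hc) 0, ← ENNReal.ofReal_inv_of_pos hc]
    congr 1
    simp [div_eq_mul_inv]

/-- The value of `E[1 / χ²_d]`: it is `1 / (d - 2)` for `d ≥ 3`, and infinite otherwise. -/
noncomputable def invChiSqMean (d : ℕ) : ℝ≥0∞ :=
  if 3 ≤ d then ENNReal.ofReal (1 / ((d : ℝ) - 2)) else ⊤

lemma lintegral_one_add_two_mul_rpow (d : ℕ) :
    ∫⁻ t in Set.Ioi (0 : ℝ), ENNReal.ofReal ((1 + 2 * t) ^ (-(d / 2) : ℝ)) = invChiSqMean d := by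
  rw [invChiSqMean]
  split_ifs with hd
  · have hd' : (3 : ℝ) ≤ d := by exact_mod_cast hd
    have hd0 : (0 : ℝ) < d - 2 := by linarith
    have hderiv : ∀ t ∈ Set.Ici (0 : ℝ),
        HasDerivAt (fun t : ℝ => -((1 + 2 * t) ^ (1 - d / 2 : ℝ) / (d - 2)))
          ((1 + 2 * t) ^ (-(d / 2) : ℝ)) t := by
      intro t ht
      have ht' : (0 : ℝ) ≤ t := ht
      have h := ((((hasDerivAt_id t).const_mul 2).const_add 1).rpow_const
        (p := (1 - d / 2 : ℝ)) (Or.inl (by simp; positivity))).div_const (d - 2 : ℝ) |>.neg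
      refine h.congr_deriv ?_
      have e : (1 - d / 2 - 1 : ℝ) = -(d / 2) := by ring
      rw [e]
      simp
      field_simp
      ring
    have hlim : Filter.Tendsto (fun t : ℝ => -((1 + 2 * t) ^ (1 - d / 2 : ℝ) / (d - 2)))
        Filter.atTop (nhds 0) := by
      have h1 : Filter.Tendsto (fun t : ℝ => 1 + 2 * t) Filter.atTop Filter.atTop :=
        Filter.tendsto_atTop_add_const_left _ _
          (Filter.tendsto_id.const_mul_atTop (by norm_num))
      have h2 := ((tendsto_rpow_neg_atTop (y := (d / 2 - 1 : ℝ)) (by linarith)).comp h1).div_const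
        (d - 2 : ℝ) |>.neg
      simpa [Function.comp_def, neg_sub] using h2
    have hnn : ∀ t ∈ Set.Ioi (0 : ℝ), 0 ≤ (1 + 2 * t) ^ (-(d / 2) : ℝ) := by
      intro t ht
      have ht' : (0 : ℝ) < t := ht
      positivity
    rw [← ofReal_integral_eq_lintegral_ofReal
      (integrableOn_Ioi_deriv_of_nonneg' hderiv hnn hlim)
      ((ae_restrict_iff' measurableSet_Ioi).2 (ae_of_all _ hnn)),
      integral_Ioi_of_hasDerivAt_of_nonneg' hderiv hnn hlim]
    simp
  · by_contra hlt
    have hlt := lt_top_iff_ne_top.2 hlt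
    -- for `t > 1` the integrand is at least `(1 + 2 t)⁻¹ ≥ (3 t)⁻¹`
    have hd' : (d : ℝ) ≤ 2 := by exact_mod_cast (by omega : d ≤ 2)
    have hle : ∫⁻ t in Set.Ioi (1 : ℝ), ENNReal.ofReal (1 / 3 * t ^ (-1 : ℝ)) < ⊤ := by
      refine lt_of_le_of_lt ((setLIntegral_mono (by fun_prop) fun t ht => ?_).trans
        (lintegral_mono_set (Set.Ioi_subset_Ioi zero_le_one))) hlt
      have ht' : (1 : ℝ) < t := ht
      apply ENNReal.ofReal_le_ofReal
      calc 1 / 3 * t ^ (-1 : ℝ) = (3 * t)⁻¹ := by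
            rw [Real.rpow_neg_one, mul_inv]; norm_num
        _ ≤ (1 + 2 * t)⁻¹ := by gcongr; linarith
        _ = (1 + 2 * t) ^ (-1 : ℝ) := (Real.rpow_neg_one _).symm
        _ ≤ _ := Real.rpow_le_rpow_of_exponent_le (by linarith) (by linarith)
    have hint : IntegrableOn (fun t : ℝ => 1 / 3 * t ^ (-1 : ℝ)) (Set.Ioi 1) := by
      refine ⟨by fun_prop, ?_⟩
      rw [hasFiniteIntegral_iff_ofReal]
      · exact hle
      · refine (ae_restrict_iff' measurableSet_Ioi).2 (ae_of_all _ fun t ht => ?_)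
        have ht' : (1 : ℝ) < t := ht
        positivity
    have := (hint.const_mul 3)
    simp only [← mul_assoc] at this
    norm_num at this
    have h2 : IntegrableOn (fun t : ℝ => t ^ (-1 : ℝ)) (Set.Ioi 1) := by
      simpa [IntegrableOn, Real.rpow_neg_one] using this
    exact lt_irrefl _ ((integrableOn_Ioi_rpow_iff one_pos).1 h2)

section InnerProductSpace

variable {E : Type*} [NormedAddCommGroup E] [InnerProductSpace ℝ E] [FiniteDimensional ℝ E]
  [MeasurableSpace E] [BorelSpace E]

/-- The mean of the reciprocal of a chi-squared variable, by integrating its Laplace transform: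
`1 / c = ∫ t > 0, exp (-t c)`. -/
lemma lintegral_inv_norm_sq_stdGaussian :
    ∫⁻ z : E, (ENNReal.ofReal (‖z‖ ^ 2))⁻¹ ∂stdGaussian E =
      invChiSqMean (Module.finrank ℝ E) := by
  simp_rw [← lintegral_exp_neg_mul_Ioi _ (sq_nonneg ‖_‖)]
  rw [lintegral_lintegral_swap (by fun_prop), ← lintegral_one_add_two_mul_rpow]
  exact setLIntegral_congr_fun measurableSet_Ioi fun t ht =>
    lintegral_exp_neg_mul_norm_sq_stdGaussian (le_of_lt ht)

lemma map_orthogonalProjectionOnto_stdGaussian (K : Submodule ℝ E) :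
    (stdGaussian E).map K.orthogonalProjectionOnto = stdGaussian K := by
  have : IsProbabilityMeasure ((stdGaussian E).map K.orthogonalProjectionOnto) :=
    Measure.isProbabilityMeasure_map (by fun_prop)
  apply Measure.ext_of_charFun
  ext t
  rw [charFun_apply, integral_map (by fun_prop) (by fun_prop), charFun_stdGaussian,
    Submodule.coe_norm t, ← charFun_stdGaussian (t : E), charFun_apply]
  simp

lemma map_inner_stdGaussian (w : E) :
    (stdGaussian E).map (fun z => inner ℝ z w) = gaussianReal 0 (‖w‖ ^ 2).toNNReal := by
  have h : (fun z : E => inner ℝ z w) = innerSL ℝ w := by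
    ext z; simp [real_inner_comm]
  rw [h, IsGaussian.map_eq_gaussianReal, variance_dual_stdGaussian, integral_strongDual_stdGaussian]
  simp

/-- A proper subspace is a null set of the standard Gaussian measure. -/
lemma ae_notMem_stdGaussian {W : Submodule ℝ E} (hW : W ≠ ⊤) :
    ∀ᵐ z ∂stdGaussian E, z ∉ W := by
  obtain ⟨v, hv, hv0⟩ := (Submodule.ne_bot_iff _).1 (mt Submodule.orthogonal_eq_bot_iff.1 hW)
  have h : ∀ᵐ r ∂(stdGaussian E).map (fun z => inner ℝ z v), r ≠ 0 := by
    rw [map_inner_stdGaussian]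
    have : NullSingletonClass (gaussianReal 0 (‖v‖ ^ 2).toNNReal) :=
      nullSingletonClass_gaussianReal (by simpa using hv0)
    simp [ae_iff]
  filter_upwards [ae_of_ae_map (by fun_prop) h] with z hz hzW
  exact hz (hv z hzW)

end InnerProductSpace

lemma lintegral_sq_gaussianReal (v : NNReal) :
    ∫⁻ r, ENNReal.ofReal (r ^ 2) ∂gaussianReal 0 v = v := by
  have h := variance_id_gaussianReal (μ := 0) (v := v)
  rw [variance_eq_integral aemeasurable_id] at h
  simp only [id, integral_id_gaussianReal, sub_zero] at h
  rw [← ofReal_integral_eq_lintegral_ofReal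
    (by simpa using (IsGaussian.memLp_two_id (μ := gaussianReal 0 v)).integrable_sq)
    (ae_of_all _ fun r => sq_nonneg r)]
  simp [h]

/-! ### Families of independent standard Gaussian vectors -/

/-- Replacing one coordinate by a fresh independent copy does not change a product measure. -/
lemma measurePreserving_update {ι : Type*} [Fintype ι] [DecidableEq ι] {α : ι → Type*}
    [∀ i, MeasurableSpace (α i)] (μ : ∀ i, Measure (α i)) [∀ i, IsProbabilityMeasure (μ i)]
    (j : ι) :
    MeasurePreserving (fun q : (∀ i, α i) × α j => Function.update q.1 j q.2)
      ((Measure.pi μ).prod (μ j)) (Measure.pi μ) := by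
  have hm : Measurable fun q : (∀ i, α i) × α j => Function.update q.1 j q.2 := measurable_update'
  refine ⟨hm, (Measure.pi_eq fun s hs => ?_).symm⟩
  rw [Measure.map_apply hm (.univ_pi hs)]
  have h : (fun q : (∀ i, α i) × α j => Function.update q.1 j q.2) ⁻¹' Set.univ.pi s =
      Set.univ.pi (Function.update s j Set.univ) ×ˢ s j := by
    ext q
    simp only [Set.mem_preimage, Set.mem_pi, Set.mem_univ, true_implies, Set.mem_prod]
    constructor
    · intro hq
      refine ⟨fun i => ?_, by simpa using hq j⟩
      by_cases hi : i = j
      · subst hi; simp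
      · simpa [hi] using hq i
    · rintro ⟨h1, h2⟩ i
      by_cases hi : i = j
      · subst hi; simpa using h2
      · simpa [hi] using h1 i
  rw [h, Measure.prod_prod, Measure.pi_pi, ← Finset.mul_prod_erase _ _ (Finset.mem_univ j),
    ← Finset.mul_prod_erase (a := j) _ (fun i => μ i (s i)) (Finset.mem_univ j)]
  rw [Finset.prod_congr rfl fun i hi => by
    rw [Function.update_of_ne (Finset.ne_of_mem_erase hi)]]
  simp [mul_comm]

section InnerProductSpace

variable {E : Type*} [NormedAddCommGroup E] [InnerProductSpace ℝ E] [FiniteDimensional ℝ E]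
  [MeasurableSpace E] [BorelSpace E] {k : Type*} [Fintype k]

/-- At most `dim E` independent standard Gaussian vectors of `E` are almost surely linearly
independent: each of them avoids the proper subspace spanned by some of the others. -/
lemma ae_linearIndependent_pi_stdGaussian (hk : Fintype.card k ≤ Module.finrank ℝ E) :
    ∀ᵐ a ∂Measure.pi (fun _ : k => stdGaussian E), LinearIndependent ℝ a := by
  classical
  suffices h : ∀ s : Finset k, ∀ᵐ a ∂Measure.pi (fun _ : k => stdGaussian E),
      LinearIndepOn ℝ a (s : Set k) by
    filter_upwards [h Finset.univ] with a ha
    simpa [linearIndepOn_univ_iff] using ha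
  intro s
  induction s using Finset.induction_on with
  | empty => simp
  | insert j s hj ih =>
    have hmeas : MeasurableSet {a : k → E | LinearIndepOn ℝ a (↑(insert j s) : Set k)} := by
      have hc : Continuous fun (a : k → E) (i : (↑(insert j s) : Set k)) => a i := by fun_prop
      exact (isOpen_setOfPred_linearIndependent.preimage hc).measurableSet
    have hpres := measurePreserving_update (fun _ : k => stdGaussian E) j
    rw [← hpres.map_eq, ae_map_iff hpres.measurable.aemeasurable hmeas]
    refine (Measure.ae_prod_iff_ae_ae (p := fun q : (k → E) × E =>
      LinearIndepOn ℝ (Function.update q.1 j q.2) (↑(insert j s) : Set k))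
      (hpres.measurable hmeas)).2 ?_
    filter_upwards [ih] with a ha
    have hW : Submodule.span ℝ (a '' (s : Set k)) ≠ ⊤ := by
      intro htop
      have h1 := finrank_span_le_card (R := ℝ) (a '' (s : Set k))
      rw [htop, finrank_top] at h1
      have h2 : (a '' (s : Set k)).toFinset.card ≤ s.card := by
        rw [Set.toFinset_image]; simpa using Finset.card_image_le (s := s) (f := a)
      have h3 : s.card < Fintype.card k := Finset.card_lt_univ_of_notMem hj
      omega
    filter_upwards [ae_notMem_stdGaussian hW] with z hz
    have heq : Set.EqOn (Function.update a j z) a (s : Set k) := fun i hi =>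
      Function.update_of_ne (ne_of_mem_of_not_mem (Finset.mem_coe.1 hi) hj) _ _
    rw [Finset.coe_insert, linearIndepOn_insert (by simpa using hj), heq.image_eq]
    exact ⟨(linearIndepOn_congr heq).2 ha, by simpa using hz⟩

lemma measurePreserving_isometry_pi_stdGaussian (O : E ≃ₗᵢ[ℝ] E) :
    MeasurePreserving (fun (a : k → E) i => O (a i)) (Measure.pi fun _ => stdGaussian E)
      (Measure.pi fun _ => stdGaussian E) := by
  refine ⟨by fun_prop, ?_⟩
  have h : (stdGaussian E).map O = stdGaussian E := stdGaussian_map O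
  have hp : ∀ _ : k, IsProbabilityMeasure ((stdGaussian E).map O) := fun _ => by
    rw [h]; infer_instance
  rw [Measure.pi_map_pi (f := fun _ : k => O) fun _ => by fun_prop]
  simp_rw [h]

end InnerProductSpace

section Transpose

variable {k m : Type*} [Fintype k] [Fintype m]

/-- The law of a Gaussian matrix, described by its rows, is invariant under transposition. -/
lemma measurePreserving_transpose_pi_stdGaussian :
    MeasurePreserving
      (fun (a : k → EuclideanSpace ℝ m) (j : m) =>
        (WithLp.toLp 2 fun i => a i j : EuclideanSpace ℝ k))
      (Measure.pi fun _ => stdGaussian (EuclideanSpace ℝ m))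
      (Measure.pi fun _ => stdGaussian (EuclideanSpace ℝ k)) := by
  have hm : Measurable (fun (a : k → EuclideanSpace ℝ m) (j : m) =>
      (WithLp.toLp 2 fun i => a i j : EuclideanSpace ℝ k)) := by fun_prop
  refine ⟨hm, ?_⟩
  have := Measure.isProbabilityMeasure_map (μ := Measure.pi fun _ : k =>
    stdGaussian (EuclideanSpace ℝ m)) hm.aemeasurable
  rw [← charFun_eq_pi_iff]
  intro t
  let t' : PiLp 2 fun _ : k => EuclideanSpace ℝ m :=
    WithLp.toLp 2 fun i => WithLp.toLp 2 fun j => t j i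
  have h := charFun_pi (μ := fun _ : k => stdGaussian (EuclideanSpace ℝ m)) t'
  rw [charFun_apply, integral_map (by fun_prop) (by fun_prop)] at h
  rw [charFun_apply, integral_map (by fun_prop) (by fun_prop),
    integral_map hm.aemeasurable (by fun_prop)]
  have hin : ∀ a : k → EuclideanSpace ℝ m,
      inner ℝ (WithLp.toLp 2 fun j => (WithLp.toLp 2 fun i => a i j : EuclideanSpace ℝ k)) t =
        inner ℝ (WithLp.toLp 2 a) t' := by
    intro a
    simp only [PiLp.inner_apply, t']
    exact Finset.sum_comm
  simp_rw [hin]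
  rw [h]
  simp_rw [charFun_stdGaussian, ← Complex.exp_sum, ← Finset.sum_div, Finset.sum_neg_distrib]
  congr 3
  norm_cast
  simp only [EuclideanSpace.real_norm_sq_eq, t']
  exact Finset.sum_comm

end Transpose

/-! ### The pseudoinverse of a matrix with given rows -/

lemma pinv_transpose {m n : Type*} [Fintype m] [Fintype n] (A : Matrix m n ℝ) :
    pinv Aᵀ = (pinv A)ᵀ := by
  obtain ⟨h1, h2, h3, h4⟩ := pinv_isMoorePenrose A
  refine (pinv_isMoorePenrose Aᵀ).unique ⟨?_, ?_, ?_, ?_⟩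
  · rw [Matrix.mul_assoc, ← Matrix.transpose_mul, ← Matrix.transpose_mul, h1]
  · rw [Matrix.mul_assoc, ← Matrix.transpose_mul, ← Matrix.transpose_mul, h2]
  · rw [← Matrix.transpose_mul, h4, h4]
  · rw [← Matrix.transpose_mul, h3, h3]

section Rows

variable {k m : Type*}

/-- The matrix with rows `a i`. -/
def rowMatrix (a : k → EuclideanSpace ℝ m) : Matrix k m ℝ :=
  Matrix.of fun i j => a i j

lemma toLp_vecMul_rowMatrix [Fintype k] (a : k → EuclideanSpace ℝ m) (x : k → ℝ) :
    WithLp.toLp 2 (x ᵥ* rowMatrix a) = ∑ i, x i • a i := by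
  ext j
  simp [rowMatrix, Matrix.vecMul, dotProduct]

lemma rowMatrix_mulVec [Fintype m] (a : k → EuclideanSpace ℝ m) (v : EuclideanSpace ℝ m) (i : k) :
    (rowMatrix a *ᵥ v) i = inner ℝ (a i) v := by
  simp [rowMatrix, Matrix.mulVec, dotProduct, PiLp.inner_apply, mul_comm]

variable [Fintype k] [Fintype m]

lemma rowMatrix_mul_pinv [DecidableEq k] {a : k → EuclideanSpace ℝ m}
    (ha : LinearIndependent ℝ a) : rowMatrix a * pinv (rowMatrix a) = 1 := by
  set A := rowMatrix a with hA
  have h0 : (A * pinv A - 1) * A = 0 := by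
    rw [Matrix.sub_mul, Matrix.one_mul, (pinv_isMoorePenrose A).mul_mul_left, sub_self]
  rw [← sub_eq_zero]
  ext i l
  refine Fintype.linearIndependent_iff.1 ha ((A * pinv A - 1 : Matrix k k ℝ) i) ?_ l
  rw [← toLp_vecMul_rowMatrix, ← hA]
  ext j
  exact congrFun (congrFun h0 i) j

lemma pinv_rowMatrix_eq [DecidableEq k] {a : k → EuclideanSpace ℝ m}
    (ha : LinearIndependent ℝ a) :
    pinv (rowMatrix a) = (rowMatrix a)ᵀ * (rowMatrix a * (rowMatrix a)ᵀ)⁻¹ := by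
  have h1 := rowMatrix_mul_pinv ha
  obtain ⟨-, h2, -, h4⟩ := pinv_isMoorePenrose (rowMatrix a)
  generalize rowMatrix a = A at *
  have h5 : Aᵀ * ((pinv A)ᵀ * pinv A) = pinv A := by
    rw [← Matrix.mul_assoc, ← Matrix.transpose_mul, h4, h2]
  rw [Matrix.inv_eq_right_inv (B := (pinv A)ᵀ * pinv A), h5]
  rw [Matrix.mul_assoc, h5, h1]

/-- `A† A` is the orthogonal projection onto the row space of `A`. -/
lemma toLp_pinv_mul_mulVec (a : k → EuclideanSpace ℝ m) (v : EuclideanSpace ℝ m) :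
    WithLp.toLp 2 ((pinv (rowMatrix a) * rowMatrix a) *ᵥ v) =
      (Submodule.span ℝ (Set.range a)).starProjection v := by
  obtain ⟨h1, -, -, h4⟩ := pinv_isMoorePenrose (rowMatrix a)
  refine (Submodule.eq_starProjection_of_mem_orthogonal ?_ ?_).symm
  · rw [← h4, Matrix.mulVec_transpose, ← Matrix.vecMul_vecMul, toLp_vecMul_rowMatrix]
    exact Submodule.sum_mem _ fun i _ =>
      Submodule.smul_mem _ _ (Submodule.subset_span (Set.mem_range_self i))
  · rw [Submodule.mem_orthogonal]
    intro u hu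
    refine Submodule.span_induction ?_ (by simp) ?_ ?_ hu
    · rintro _ ⟨i, rfl⟩
      rw [inner_sub_right, ← rowMatrix_mulVec, ← rowMatrix_mulVec, Matrix.mulVec_mulVec,
        ← Matrix.mul_assoc, h1, sub_self]
    · intro x y _ _ hx hy
      rw [inner_add_left, hx, hy, add_zero]
    · intro c x _ hx
      rw [inner_smul_left, hx, mul_zero]

end Rows

/-- If `c` is the vector of `span a` dual to `a j`, and `r` the residual of `a j` after projecting
on the other vectors, then `c = r / ‖r‖²`; in particular `‖c‖² ‖r‖² = 1`. -/
lemma norm_sq_mul_norm_sq_residual {E k : Type*} [NormedAddCommGroup E] [InnerProductSpace ℝ E]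
    [FiniteDimensional ℝ E] {a : k → E} {c : E} {j : k}
    (hc : c ∈ Submodule.span ℝ (Set.range a)) (hj : inner ℝ (a j) c = 1)
    (hne : ∀ i, i ≠ j → inner ℝ (a i) c = 0) :
    ‖c‖ ^ 2 * ‖(Submodule.span ℝ (a '' {j}ᶜ))ᗮ.orthogonalProjectionOnto (a j)‖ ^ 2 = 1 := by
  set W := Submodule.span ℝ (a '' {j}ᶜ) with hW
  rw [Submodule.coe_norm, ← Submodule.starProjection_apply]
  set r := Wᗮ.starProjection (a j) with hr
  have hcW : c ∈ Wᗮ := by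
    rw [Submodule.mem_orthogonal]
    intro u hu
    refine Submodule.span_induction ?_ (by simp) ?_ ?_ hu
    · rintro _ ⟨i, hi, rfl⟩
      exact hne i hi
    · intro x y _ _ hx hy
      rw [inner_add_left, hx, hy, add_zero]
    · intro c x _ hx
      rw [inner_smul_left, hx, mul_zero]
  have hrange : Set.range a = insert (a j) (a '' {j}ᶜ) := by
    rw [← Set.image_insert_eq, ← Set.image_univ]
    congr 1
    ext i
    simp [em]
  rw [hrange, Submodule.mem_span_insert] at hc
  obtain ⟨α, w, hw, hcw⟩ := hc
  have h1 : c = α • r := by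
    have h2 : Wᗮ.starProjection w = 0 := by
      rw [Submodule.starProjection_apply_eq_zero_iff, Submodule.orthogonal_orthogonal]
      exact hw
    rw [hr, ← map_smul, ← add_zero (Wᗮ.starProjection _), ← h2, ← map_add, ← hcw]
    exact (Submodule.starProjection_eq_self_iff.2 hcW).symm
  have h3 : α * ‖r‖ ^ 2 = 1 := by
    rw [← hj, ← Submodule.starProjection_eq_self_iff.2 hcW,
      ← Submodule.inner_starProjection_left_eq_right, ← hr, h1, inner_smul_right,
      real_inner_self_eq_norm_sq]
  rw [h1, norm_smul, mul_pow, Real.norm_eq_abs, sq_abs]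
  linear_combination (α * ‖r‖ ^ 2 + 1) * h3

section Rows

variable {k m : Type*} [Fintype k] [Fintype m]

lemma norm_sq_pinv_col_mul_norm_sq_residual {a : k → EuclideanSpace ℝ m}
    (ha : LinearIndependent ℝ a) (j : k) :
    (∑ l, pinv (rowMatrix a) l j ^ 2) *
      ‖(Submodule.span ℝ (a '' {j}ᶜ))ᗮ.orthogonalProjectionOnto (a j)‖ ^ 2 = 1 := by
  classical
  set c : EuclideanSpace ℝ m := WithLp.toLp 2 fun l => pinv (rowMatrix a) l j with hc
  have h0 : ‖c‖ ^ 2 = ∑ l, pinv (rowMatrix a) l j ^ 2 := by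
    rw [EuclideanSpace.real_norm_sq_eq]
  have hin : ∀ i, inner ℝ (a i) c = (1 : Matrix k k ℝ) i j := by
    intro i
    rw [← rowMatrix_mulVec, ← rowMatrix_mul_pinv ha]
    rfl
  rw [← h0]
  refine norm_sq_mul_norm_sq_residual ?_ (by simp [hin]) fun i hi => by simp [hin, hi]
  rw [← Submodule.starProjection_eq_self_iff, ← toLp_pinv_mul_mulVec]
  ext l
  exact congrFun (congrFun (pinv_isMoorePenrose (rowMatrix a)).mul_mul_right l) j

lemma aemeasurable_pinv_rowMatrix_of_card_le (h : Fintype.card k ≤ Fintype.card m)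
    (l : m) (j : k) :
    AEMeasurable (fun a : k → EuclideanSpace ℝ m => pinv (rowMatrix a) l j)
      (Measure.pi fun _ => stdGaussian (EuclideanSpace ℝ m)) := by
  classical
  have hA : Continuous fun a : k → EuclideanSpace ℝ m => rowMatrix a := by
    refine continuous_matrix fun i j => ?_
    simp only [rowMatrix, Matrix.of_apply]
    fun_prop
  have hG : Continuous fun a : k → EuclideanSpace ℝ m => rowMatrix a * (rowMatrix a)ᵀ :=
    hA.matrix_mul hA.matrix_transpose
  refine ⟨fun a => ((rowMatrix a)ᵀ * (rowMatrix a * (rowMatrix a)ᵀ)⁻¹) l j, ?_, ?_⟩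
  · simp only [Matrix.inv_def, Ring.inverse_eq_inv', Matrix.mul_smul, Matrix.smul_apply,
      smul_eq_mul]
    exact hG.matrix_det.measurable.inv.mul
      ((hA.matrix_transpose.matrix_mul hG.matrix_adjugate).matrix_elem l j).measurable
  · filter_upwards [ae_linearIndependent_pi_stdGaussian (E := EuclideanSpace ℝ m) (k := k)
      (by simpa using h)] with a ha
    rw [pinv_rowMatrix_eq ha]

/-- Wide matrices almost surely have an explicit pseudoinverse, and tall ones are transposes of
wide ones. -/
lemma aemeasurable_pinv_rowMatrix (l : m) (j : k) :
    AEMeasurable (fun a : k → EuclideanSpace ℝ m => pinv (rowMatrix a) l j)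
      (Measure.pi fun _ => stdGaussian (EuclideanSpace ℝ m)) := by
  rcases le_total (Fintype.card k) (Fintype.card m) with h | h
  · exact aemeasurable_pinv_rowMatrix_of_card_le h l j
  · have h1 := AEMeasurable.comp_quasiMeasurePreserving
      (aemeasurable_pinv_rowMatrix_of_card_le (k := m) (m := k) h j l)
      (measurePreserving_transpose_pi_stdGaussian (k := k) (m := m)).quasiMeasurePreserving
    refine h1.congr (ae_of_all _ fun a => ?_)
    exact congrFun (congrFun (pinv_transpose (rowMatrix a)) j) l

end Rows

/-! ### Moments of the pseudoinverse of a Gaussian matrix -/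

section

variable {k m : Type*} [Fintype k] [Fintype m]

/-- Given the other rows, the `j`-th column of the pseudoinverse has squared norm `1 / ‖r‖²` with `r`
standard Gaussian on the orthogonal complement of their span. -/
lemma lintegral_norm_sq_pinv_col (h : Fintype.card k ≤ Fintype.card m) (j : k) :
    ∫⁻ a, ENNReal.ofReal (∑ l, pinv (rowMatrix a) l j ^ 2)
        ∂Measure.pi (fun _ : k => stdGaussian (EuclideanSpace ℝ m)) =
      invChiSqMean (Fintype.card m - Fintype.card k + 1) := by
  classical
  set μ := Measure.pi (fun _ : k => stdGaussian (EuclideanSpace ℝ m)) with hμ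
  -- conditioning on the rows other than the `j`-th is done by resampling the `j`-th row
  have hpres := measurePreserving_update (fun _ : k => stdGaussian (EuclideanSpace ℝ m)) j
  rw [← hμ] at hpres
  have hf : AEMeasurable (fun a => ENNReal.ofReal (∑ l, pinv (rowMatrix a) l j ^ 2)) μ :=
    (Finset.univ.aemeasurable_fun_sum fun l _ =>
      (aemeasurable_pinv_rowMatrix l j).pow_const 2).ennreal_ofReal
  have hli := ae_linearIndependent_pi_stdGaussian (E := EuclideanSpace ℝ m) (k := k)
    (by simpa using h)
  rw [← hμ] at hli
  have hf' := hf
  rw [← hpres.map_eq] at hf' hli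
  rw [← hpres.map_eq, lintegral_map' hf' hpres.measurable.aemeasurable]
  refine (lintegral_prod _ (hf'.comp_aemeasurable hpres.measurable.aemeasurable)).trans ?_
  have hli2 := Measure.ae_ae_of_ae_prod (ae_of_ae_map hpres.measurable.aemeasurable hli)
  have key : ∀ᵐ a ∂μ, ∫⁻ z, ENNReal.ofReal
      (∑ l, pinv (rowMatrix (Function.update a j z)) l j ^ 2) ∂stdGaussian (EuclideanSpace ℝ m) =
      invChiSqMean (Fintype.card m - Fintype.card k + 1) := by
    filter_upwards [hli2] with a ha
    set W := Submodule.span ℝ (a '' {j}ᶜ) with hW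
    have heq : ∀ z, Set.EqOn (Function.update a j z) a {j}ᶜ := fun z i hi =>
      Function.update_of_ne hi _ _
    have hdim : Module.finrank ℝ Wᗮ = Fintype.card m - Fintype.card k + 1 := by
      obtain ⟨z, hz⟩ := ha.exists
      have h1 : LinearIndepOn ℝ a ({j}ᶜ : Set k) :=
        (linearIndepOn_congr (heq z)).1 (hz.linearIndepOn _)
      have h2 : Module.finrank ℝ W = Fintype.card k - 1 := by
        rw [hW, Set.image_eq_range]
        have := finrank_span_eq_card (R := ℝ) h1
        rw [this, Fintype.card_compl_set]
        simp
      have h3 := W.finrank_add_finrank_orthogonal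
      rw [finrank_euclideanSpace, h2] at h3
      have h4 : 0 < Fintype.card k := Fintype.card_pos_iff.2 ⟨j⟩
      omega
    rw [← hdim, ← lintegral_inv_norm_sq_stdGaussian, ← map_orthogonalProjectionOnto_stdGaussian,
      lintegral_map (by fun_prop) (by fun_prop)]
    refine lintegral_congr_ae ?_
    filter_upwards [ha] with z hz
    have h1 := norm_sq_pinv_col_mul_norm_sq_residual hz j
    rw [(heq z).image_eq, ← hW, Function.update_self] at h1
    have h2 : 0 < ‖Wᗮ.orthogonalProjectionOnto z‖ ^ 2 := by
      refine lt_of_le_of_ne (sq_nonneg _) fun h0 => ?_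
      rw [← h0, mul_zero] at h1
      exact zero_ne_one h1
    rw [← ENNReal.ofReal_inv_of_pos h2, eq_inv_of_mul_eq_one_left h1]
  simp only [Function.comp_apply]
  rw [lintegral_congr_ae key]
  simp

/-- The expected squared Frobenius norm of the pseudoinverse of a wide Gaussian matrix. -/
lemma lintegral_frobenius_pinv_of_card_le (h : Fintype.card k ≤ Fintype.card m) :
    ∫⁻ a, ENNReal.ofReal (∑ j, ∑ l, pinv (rowMatrix a) l j ^ 2)
        ∂Measure.pi (fun _ : k => stdGaussian (EuclideanSpace ℝ m)) =
      Fintype.card k * invChiSqMean (Fintype.card m - Fintype.card k + 1) := by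
  have h1 : ∀ a : k → EuclideanSpace ℝ m, ENNReal.ofReal (∑ j, ∑ l, pinv (rowMatrix a) l j ^ 2) =
      ∑ j, ENNReal.ofReal (∑ l, pinv (rowMatrix a) l j ^ 2) := fun a =>
    ENNReal.ofReal_sum_of_nonneg fun j _ => Finset.sum_nonneg fun l _ => sq_nonneg _
  simp_rw [h1]
  rw [lintegral_finsetSum' _ fun j _ => (Finset.univ.aemeasurable_fun_sum fun l _ =>
      (aemeasurable_pinv_rowMatrix l j).pow_const 2).ennreal_ofReal]
  simp [lintegral_norm_sq_pinv_col h]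

/-- The tall case, by transposition. -/
lemma lintegral_frobenius_pinv_of_card_ge (h : Fintype.card m ≤ Fintype.card k) :
    ∫⁻ a, ENNReal.ofReal (∑ j, ∑ l, pinv (rowMatrix a) l j ^ 2)
        ∂Measure.pi (fun _ : k => stdGaussian (EuclideanSpace ℝ m)) =
      Fintype.card m * invChiSqMean (Fintype.card k - Fintype.card m + 1) := by
  rw [← lintegral_frobenius_pinv_of_card_le h,
    ← (measurePreserving_transpose_pi_stdGaussian (k := k) (m := m)).map_eq, lintegral_map']
  · refine lintegral_congr fun a => ?_
    rw [Finset.sum_comm]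
    congr 1
    refine Finset.sum_congr rfl fun j _ => Finset.sum_congr rfl fun l _ => ?_
    exact congrArg (· ^ 2) (congrFun (congrFun (pinv_transpose (rowMatrix a)) l) j).symm
  · rw [(measurePreserving_transpose_pi_stdGaussian (k := k) (m := m)).map_eq]
    exact (Finset.univ.aemeasurable_fun_sum fun j _ => Finset.univ.aemeasurable_fun_sum fun l _ =>
      (aemeasurable_pinv_rowMatrix l j).pow_const 2).ennreal_ofReal
  · exact (measurePreserving_transpose_pi_stdGaussian (k := k) (m := m)).measurable.aemeasurable

/-- The vector `(1 - A† A) v`, where `A` is the matrix with rows `a i`: the part of `v` that is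
lost when `v` is estimated by `A† (A v)`. -/
noncomputable def bias (a : k → EuclideanSpace ℝ m) (v : EuclideanSpace ℝ m) :
    EuclideanSpace ℝ m :=
  v - WithLp.toLp 2 ((pinv (rowMatrix a) * rowMatrix a) *ᵥ v)

lemma bias_eq_starProjection (a : k → EuclideanSpace ℝ m) (v : EuclideanSpace ℝ m) :
    bias a v = (Submodule.span ℝ (Set.range a))ᗮ.starProjection v := by
  rw [bias, toLp_pinv_mul_mulVec, Submodule.starProjection_orthogonal_val]

lemma aemeasurable_norm_sq_bias (v : EuclideanSpace ℝ m) :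
    AEMeasurable (fun a : k → EuclideanSpace ℝ m => ENNReal.ofReal (‖bias a v‖ ^ 2))
      (Measure.pi fun _ => stdGaussian (EuclideanSpace ℝ m)) := by
  have h : ∀ l : m, AEMeasurable (fun a : k → EuclideanSpace ℝ m => bias a v l)
      (Measure.pi fun _ => stdGaussian (EuclideanSpace ℝ m)) := by
    intro l
    simp only [bias, PiLp.sub_apply, Matrix.mulVec, dotProduct, Matrix.mul_apply]
    refine aemeasurable_const.sub (Finset.univ.aemeasurable_fun_sum fun i _ =>
      (Finset.univ.aemeasurable_fun_sum fun j _ =>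
        (aemeasurable_pinv_rowMatrix l j).mul ?_).mul_const _)
    simp only [rowMatrix, Matrix.of_apply]
    exact Measurable.aemeasurable (by fun_prop)
  simp_rw [EuclideanSpace.real_norm_sq_eq]
  exact (Finset.univ.aemeasurable_fun_sum fun l _ => (h l).pow_const 2).ennreal_ofReal

lemma norm_bias_isometry (O : EuclideanSpace ℝ m ≃ₗᵢ[ℝ] EuclideanSpace ℝ m)
    (a : k → EuclideanSpace ℝ m) (v : EuclideanSpace ℝ m) :
    ‖bias (fun i => O (a i)) (O v)‖ = ‖bias a v‖ := by
  have h : Submodule.span ℝ (Set.range fun i => O (a i)) =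
      (Submodule.span ℝ (Set.range a)).map (O.toLinearEquiv : _ →ₗ[ℝ] _) := by
    rw [Submodule.map_span, ← Set.range_comp]
    rfl
  rw [bias_eq_starProjection, bias_eq_starProjection, h, Submodule.starProjection_orthogonal_val,
    Submodule.starProjection_orthogonal_val]
  have h2 := Submodule.starProjection_map_apply O (Submodule.span ℝ (Set.range a)) (O v)
  simp only [LinearIsometryEquiv.symm_apply_apply] at h2
  rw [h2, ← map_sub, O.norm_map]

/-- Vectors of the same norm are exchanged by a reflection, which preserves the law of the rows. -/
lemma lintegral_norm_sq_bias_congr {v w : EuclideanSpace ℝ m} (h : ‖v‖ = ‖w‖) :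
    ∫⁻ a, ENNReal.ofReal (‖bias a v‖ ^ 2)
        ∂Measure.pi (fun _ : k => stdGaussian (EuclideanSpace ℝ m)) =
      ∫⁻ a, ENNReal.ofReal (‖bias a w‖ ^ 2)
        ∂Measure.pi (fun _ : k => stdGaussian (EuclideanSpace ℝ m)) := by
  set O := Submodule.reflection (ℝ ∙ (v - w))ᗮ
  have hO : O v = w := Submodule.reflection_sub h
  have hp := measurePreserving_isometry_pi_stdGaussian (k := k) O
  conv_rhs => rw [← hp.map_eq]
  rw [lintegral_map' (by rw [hp.map_eq]; exact aemeasurable_norm_sq_bias w)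
    hp.measurable.aemeasurable]
  refine lintegral_congr fun a => ?_
  rw [← hO, norm_bias_isometry]

lemma sum_norm_sq_starProjection {ι E : Type*} [Fintype ι] [NormedAddCommGroup E]
    [InnerProductSpace ℝ E] [FiniteDimensional ℝ E] (b : OrthonormalBasis ι ℝ E)
    (K : Submodule ℝ E) : ∑ i, ‖K.starProjection (b i)‖ ^ 2 = Module.finrank ℝ K := by
  have h : ∀ i, ‖K.starProjection (b i)‖ ^ 2 =
      ∑ l, inner ℝ (stdOrthonormalBasis ℝ K l : E) (b i) ^ 2 := by
    intro i
    rw [Submodule.starProjection_apply, ← Submodule.coe_norm,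
      ← (stdOrthonormalBasis ℝ K).sum_sq_inner_right]
    simp
  simp_rw [h]
  rw [Finset.sum_comm]
  have h2 : ∀ l, ∑ i, inner ℝ (stdOrthonormalBasis ℝ K l : E) (b i) ^ 2 = 1 := by
    intro l
    rw [b.sum_sq_inner_left, ← Submodule.coe_norm, (stdOrthonormalBasis ℝ K).norm_eq_one, one_pow]
  simp [h2]

/-- By rotation invariance the expectation depends on `v` only through `‖v‖`; summed over an
orthonormal basis it is the dimension `|m| - |k|` of the orthogonal complement of the row
space. -/
lemma lintegral_norm_sq_bias (h : Fintype.card k ≤ Fintype.card m) (v : EuclideanSpace ℝ m) :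
    ∫⁻ a, ENNReal.ofReal (‖bias a v‖ ^ 2)
        ∂Measure.pi (fun _ : k => stdGaussian (EuclideanSpace ℝ m)) =
      ENNReal.ofReal (‖v‖ ^ 2 * (1 - Fintype.card k / Fintype.card m)) := by
  classical
  set μ := Measure.pi (fun _ : k => stdGaussian (EuclideanSpace ℝ m)) with hμ
  -- for empty `m` the quotient on the right is a junk value, but `v = 0`
  rcases isEmpty_or_nonempty m with hm | hm
  · have : ∀ w : EuclideanSpace ℝ m, w = 0 := fun w => Subsingleton.elim _ _
    simp [this v, this (bias _ _)]
  have hcard : (0 : ℝ) < Fintype.card m := by exact_mod_cast Fintype.card_pos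
  have hsum : ∑ j : m, ∫⁻ a, ENNReal.ofReal
      (‖bias a (‖v‖ • EuclideanSpace.basisFun m ℝ j)‖ ^ 2) ∂μ =
      ENNReal.ofReal (‖v‖ ^ 2 * (Fintype.card m - Fintype.card k)) := by
    rw [← lintegral_finsetSum' _ fun j _ => aemeasurable_norm_sq_bias _]
    have hli := ae_linearIndependent_pi_stdGaussian (E := EuclideanSpace ℝ m) (k := k)
      (by simpa using h)
    have h2 : ∀ᵐ a ∂μ, ∑ j : m, ENNReal.ofReal
        (‖bias a (‖v‖ • EuclideanSpace.basisFun m ℝ j)‖ ^ 2) =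
        ENNReal.ofReal (‖v‖ ^ 2 * (Fintype.card m - Fintype.card k)) := by
      filter_upwards [hli] with a ha
      rw [← ENNReal.ofReal_sum_of_nonneg fun j _ => sq_nonneg _]
      simp_rw [bias_eq_starProjection, map_smul, norm_smul, mul_pow, norm_norm]
      rw [← Finset.mul_sum, sum_norm_sq_starProjection]
      have h3 := (Submodule.span ℝ (Set.range a)).finrank_add_finrank_orthogonal
      rw [finrank_euclideanSpace, finrank_span_eq_card ha] at h3
      rw [← h3]
      push_cast
      ring_nf
    rw [lintegral_congr_ae h2]
    simp
  have hconst : ∀ j : m, ∫⁻ a, ENNReal.ofReal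
      (‖bias a (‖v‖ • EuclideanSpace.basisFun m ℝ j)‖ ^ 2) ∂μ =
      ∫⁻ a, ENNReal.ofReal (‖bias a v‖ ^ 2) ∂μ := fun j =>
    lintegral_norm_sq_bias_congr (by rw [norm_smul, OrthonormalBasis.norm_eq_one]; simp)
  simp_rw [hconst] at hsum
  rw [Finset.sum_const, Finset.card_univ, nsmul_eq_mul] at hsum
  have hc0 : ((Fintype.card m : ℕ) : ℝ≥0∞) ≠ 0 := by exact_mod_cast Fintype.card_ne_zero
  rw [← ENNReal.mul_right_inj hc0 (ENNReal.natCast_ne_top _), hsum, ← ENNReal.ofReal_natCast,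
    ← ENNReal.ofReal_mul hcard.le]
  congr 1
  field_simp

/-- A tall Gaussian matrix almost surely has linearly independent columns, so that `A† A = 1`. -/
lemma lintegral_norm_sq_bias_eq_zero (h : Fintype.card m ≤ Fintype.card k) (v : EuclideanSpace ℝ m) :
    ∫⁻ a, ENNReal.ofReal (‖bias a v‖ ^ 2)
        ∂Measure.pi (fun _ : k => stdGaussian (EuclideanSpace ℝ m)) = 0 := by
  classical
  have hli := ae_linearIndependent_pi_stdGaussian (E := EuclideanSpace ℝ k) (k := m)
    (by simpa using h)
  have ht := measurePreserving_transpose_pi_stdGaussian (k := k) (m := m)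
  rw [← ht.map_eq] at hli
  have h0 : ∀ᵐ a ∂Measure.pi (fun _ : k => stdGaussian (EuclideanSpace ℝ m)),
      ENNReal.ofReal (‖bias a v‖ ^ 2) = 0 := by
    filter_upwards [ae_of_ae_map ht.measurable.aemeasurable hli] with a ha
    have h1 : (rowMatrix a)ᵀ * pinv (rowMatrix a)ᵀ = 1 := rowMatrix_mul_pinv ha
    rw [pinv_transpose, ← Matrix.transpose_mul, ← Matrix.transpose_one] at h1
    have h2 := Matrix.transpose_injective h1
    simp [bias, h2]
  rw [lintegral_congr_ae h0, lintegral_zero]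

end

/-! ### The joint law of the selected features and of the residual noise -/

section Subvec

variable {D : ℕ} (T : Finset (Fin D))

lemma sum_eq_sum_add_sum_compl (f : Fin D → ℝ) :
    ∑ j, f j = ∑ j : T, f j + ∑ j : (Tᶜ : Finset (Fin D)), f j := by
  rw [Finset.sum_coe_sort T, Finset.sum_coe_sort Tᶜ, Finset.sum_add_sum_compl]

lemma inner_eq_inner_subvec_add (v w : EuclideanSpace ℝ (Fin D)) :
    inner ℝ v w = inner ℝ (subvec T v) (subvec T w) + inner ℝ (subvec Tᶜ v) (subvec Tᶜ w) := by
  simp only [PiLp.inner_apply, subvec]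
  exact sum_eq_sum_add_sum_compl T _

lemma norm_sq_eq_norm_sq_subvec_add (v : EuclideanSpace ℝ (Fin D)) :
    ‖v‖ ^ 2 = ‖subvec T v‖ ^ 2 + ‖subvec Tᶜ v‖ ^ 2 := by
  simp only [← real_inner_self_eq_norm_sq]
  exact inner_eq_inner_subvec_add T v v

lemma continuous_subvec : Continuous (subvec T) := by
  unfold subvec
  fun_prop

/-- The selected features are standard Gaussian, and independent of the contribution of the
discarded features and of the noise, which is centred Gaussian of variance `‖β_{Tᶜ}‖² + σ²`. -/
lemma map_subvec_noise (β : EuclideanSpace ℝ (Fin D)) (σ : ℝ) :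
    ((stdGaussian (EuclideanSpace ℝ (Fin D))).prod (gaussianReal 0 1)).map
      (fun q => (subvec T q.1, inner ℝ (subvec Tᶜ q.1) (subvec Tᶜ β) + σ * q.2)) =
    (stdGaussian (EuclideanSpace ℝ T)).prod
      (gaussianReal 0 (‖subvec Tᶜ β‖ ^ 2 + σ ^ 2).toNNReal) := by
  have hc1 := continuous_subvec T
  have hc2 := continuous_subvec Tᶜ
  have hm : Measurable fun q : EuclideanSpace ℝ (Fin D) × ℝ =>
      (subvec T q.1, inner ℝ (subvec Tᶜ q.1) (subvec Tᶜ β) + σ * q.2) :=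
    Continuous.measurable (by fun_prop)
  have := Measure.isProbabilityMeasure_map
    (μ := (stdGaussian (EuclideanSpace ℝ (Fin D))).prod (gaussianReal 0 1)) hm.aemeasurable
  rw [← charFun_eq_prod_iff]
  intro t
  -- the linear form `t` pulled back to the original variables
  set w : EuclideanSpace ℝ (Fin D) :=
    WithLp.toLp 2 fun j => if h : j ∈ T then t.fst ⟨j, h⟩ else t.snd * β j with hw
  have hw1 : subvec T w = t.fst := by
    ext j
    simp [subvec, hw]
  have hw2 : subvec Tᶜ w = t.snd • subvec Tᶜ β := by
    ext j
    have hj : (j : Fin D) ∉ T := Finset.mem_compl.1 j.2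
    simp [subvec, hw, hj]
  have h := charFun_prod (μ := stdGaussian (EuclideanSpace ℝ (Fin D))) (ν := gaussianReal 0 1)
    (WithLp.toLp 2 (w, σ * t.snd))
  rw [charFun_apply, integral_map (by fun_prop) (by fun_prop)] at h
  rw [charFun_apply, integral_map (by fun_prop) (by fun_prop),
    integral_map hm.aemeasurable (by fun_prop)]
  have hin : ∀ q : EuclideanSpace ℝ (Fin D) × ℝ,
      inner ℝ (WithLp.toLp 2
        (subvec T q.1, inner ℝ (subvec Tᶜ q.1) (subvec Tᶜ β) + σ * q.2)) t =
      inner ℝ (WithLp.toLp 2 q) (WithLp.toLp 2 (w, σ * t.snd)) := by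
    intro q
    simp only [WithLp.prod_inner_apply]
    rw [inner_eq_inner_subvec_add T q.1 w, hw1, hw2, inner_smul_right]
    simp
    ring
  simp_rw [hin]
  rw [h, charFun_stdGaussian, charFun_stdGaussian, charFun_gaussianReal, charFun_gaussianReal,
    ← Complex.exp_add, ← Complex.exp_add]
  congr 1
  have hn := norm_sq_eq_norm_sq_subvec_add T w
  rw [hw1, hw2, norm_smul, mul_pow, Real.norm_eq_abs, sq_abs] at hn
  have hv : ((‖subvec Tᶜ β‖ ^ 2 + σ ^ 2).toNNReal : ℝ) = ‖subvec Tᶜ β‖ ^ 2 + σ ^ 2 :=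
    Real.coe_toNNReal _ (by positivity)
  have e1 : ((‖w‖ : ℂ)) ^ 2 =
      (‖t.fst‖ : ℂ) ^ 2 + (t.snd : ℂ) ^ 2 * (‖subvec Tᶜ β‖ : ℂ) ^ 2 := by
    exact_mod_cast hn
  have e2 : ((((‖subvec Tᶜ β‖ ^ 2 + σ ^ 2).toNNReal : ℝ) : ℂ)) =
      (‖subvec Tᶜ β‖ : ℂ) ^ 2 + (σ : ℂ) ^ 2 := by
    rw [hv]; push_cast; ring
  simp only [WithLp.ofLp_fst, WithLp.ofLp_snd]
  rw [e1, e2]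
  push_cast
  ring

end Subvec

/-- The prediction error of fixed coefficients `b` at a fresh data point. -/
lemma lintegral_sq_sub_inner {D : ℕ} (β b : EuclideanSpace ℝ (Fin D)) (σ : ℝ) :
    ∫⁻ q, ENNReal.ofReal ((inner ℝ q.1 β + σ * q.2 - inner ℝ q.1 b) ^ 2)
        ∂(stdGaussian (EuclideanSpace ℝ (Fin D))).prod (gaussianReal 0 1) =
      ENNReal.ofReal (‖β - b‖ ^ 2 + σ ^ 2) := by
  -- with no feature selected, all of `⟨x, β - b⟩` counts as noise
  have h := map_subvec_noise ∅ (β - b) σ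
  have hn : ‖subvec ∅ᶜ (β - b)‖ ^ 2 = ‖β - b‖ ^ 2 := by
    rw [norm_sq_eq_norm_sq_subvec_add ∅ (β - b), Subsingleton.elim (subvec ∅ (β - b)) 0]
    simp
  have hc1 := continuous_subvec (D := D) ∅
  have hc2 := continuous_subvec (D := D) ∅ᶜ
  have h2 : ∫⁻ q, ENNReal.ofReal (q.2 ^ 2)
      ∂(stdGaussian (EuclideanSpace ℝ (∅ : Finset (Fin D)))).prod
      (gaussianReal 0 (‖subvec ∅ᶜ (β - b)‖ ^ 2 + σ ^ 2).toNNReal) =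
      ENNReal.ofReal (‖β - b‖ ^ 2 + σ ^ 2) := by
    rw [lintegral_prod _ (by fun_prop)]
    simp only [lintegral_sq_gaussianReal, lintegral_const, measure_univ, mul_one, hn]
    rfl
  rw [← h2, ← h, lintegral_map (by fun_prop) (Continuous.measurable (by fun_prop))]
  refine lintegral_congr fun q => ?_
  congr 2
  have h3 := inner_eq_inner_subvec_add ∅ q.1 (β - b)
  rw [Subsingleton.elim (subvec ∅ (β - b)) 0, inner_zero_right, zero_add] at h3
  rw [← h3, inner_sub_right]
  ring

/-! ### Averaging over the noise -/

section Noise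

variable {k m : Type*} [Fintype k] [Fintype m]

lemma map_inner_pi_gaussianReal (v : NNReal) (w : EuclideanSpace ℝ k) :
    (Measure.pi fun _ : k => gaussianReal 0 v).map (fun η => inner ℝ (WithLp.toLp 2 η) w) =
      gaussianReal 0 (v * (‖w‖ ^ 2).toNNReal) := by
  have hm : Measurable fun η : k → ℝ => (inner ℝ (WithLp.toLp 2 η) w : ℝ) := by fun_prop
  have := Measure.isProbabilityMeasure_map
    (μ := Measure.pi fun _ : k => gaussianReal 0 v) hm.aemeasurable
  apply Measure.ext_of_charFun
  ext t
  have h := charFun_pi (μ := fun _ : k => gaussianReal 0 v) (WithLp.toLp 2 (t • w).ofLp)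
  rw [charFun_apply, integral_map (by fun_prop) (by fun_prop)] at h
  rw [charFun_apply, integral_map hm.aemeasurable (by fun_prop), charFun_gaussianReal]
  have hin : ∀ η : k → ℝ, inner ℝ (inner ℝ (WithLp.toLp 2 η) w) t =
      inner ℝ (WithLp.toLp 2 η) (WithLp.toLp 2 (t • w).ofLp) := by
    intro η
    simp [inner_smul_right]
  simp_rw [hin]
  refine h.trans ?_
  simp_rw [charFun_gaussianReal, ← Complex.exp_sum]
  congr 1
  rw [NNReal.coe_mul, Real.coe_toNNReal _ (sq_nonneg _), EuclideanSpace.real_norm_sq_eq]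
  push_cast
  simp only [PiLp.smul_apply, smul_eq_mul, mul_zero, zero_mul, zero_sub, Complex.ofReal_mul]
  rw [Finset.sum_neg_distrib, ← Finset.sum_div, Finset.mul_sum, Finset.sum_mul]
  congr 2
  exact Finset.sum_congr rfl fun i _ => by ring

lemma lintegral_norm_sq_mulVec_gaussian (v : NNReal) (B : Matrix m k ℝ) :
    ∫⁻ η, ENNReal.ofReal (∑ l, (B *ᵥ η) l ^ 2) ∂Measure.pi (fun _ : k => gaussianReal 0 v) =
      v * ENNReal.ofReal (∑ j, ∑ l, B l j ^ 2) := by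
  have h1 : ∀ η : k → ℝ, ENNReal.ofReal (∑ l, (B *ᵥ η) l ^ 2) =
      ∑ l, ENNReal.ofReal ((inner ℝ (WithLp.toLp 2 η) (WithLp.toLp 2 (B l))) ^ 2) := by
    intro η
    rw [ENNReal.ofReal_sum_of_nonneg fun l _ => sq_nonneg _]
    simp [Matrix.mulVec, dotProduct, PiLp.inner_apply]
  have h2 : ENNReal.ofReal (∑ j, ∑ l, B l j ^ 2) = ∑ l, ENNReal.ofReal (∑ j, B l j ^ 2) := by
    rw [Finset.sum_comm]
    exact ENNReal.ofReal_sum_of_nonneg fun l _ => Finset.sum_nonneg fun j _ => sq_nonneg _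
  simp_rw [h1]
  rw [lintegral_finsetSum _ fun l _ => by fun_prop, h2, Finset.mul_sum]
  refine Finset.sum_congr rfl fun l _ => ?_
  rw [← lintegral_map (f := fun r : ℝ => ENNReal.ofReal (r ^ 2))
    (g := fun η : k → ℝ => inner ℝ (WithLp.toLp 2 η) (WithLp.toLp 2 (B l))) (by fun_prop)
    (by fun_prop), map_inner_pi_gaussianReal, lintegral_sq_gaussianReal, ENNReal.coe_mul]
  congr 1
  rw [← EuclideanSpace.real_norm_sq_eq (WithLp.toLp 2 (B l))]
  rfl

/-- Bias-variance decomposition of the estimation error, for a fixed noise vector `η`. -/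
lemma norm_sq_sub_pinv_mulVec (a : k → EuclideanSpace ℝ m) (v : EuclideanSpace ℝ m) (η : k → ℝ) :
    ‖v - WithLp.toLp 2 (pinv (rowMatrix a) *ᵥ (rowMatrix a *ᵥ v + η))‖ ^ 2 =
      ‖bias a v‖ ^ 2 + ∑ l, (pinv (rowMatrix a) *ᵥ η) l ^ 2 := by
  set u : EuclideanSpace ℝ m := WithLp.toLp 2 (pinv (rowMatrix a) *ᵥ η) with hu
  have h1 : v - WithLp.toLp 2 (pinv (rowMatrix a) *ᵥ (rowMatrix a *ᵥ v + η)) = bias a v - u := by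
    rw [Matrix.mulVec_add, Matrix.mulVec_mulVec, WithLp.toLp_add, bias, sub_sub]
  have h2 : u ∈ Submodule.span ℝ (Set.range a) := by
    rw [← Submodule.starProjection_eq_self_iff, ← toLp_pinv_mul_mulVec, hu, WithLp.ofLp_toLp,
      Matrix.mulVec_mulVec, (pinv_isMoorePenrose (rowMatrix a)).mul_mul_right]
  have h3 : inner ℝ (bias a v) u = 0 := by
    rw [bias_eq_starProjection]
    exact Submodule.inner_left_of_mem_orthogonal h2 (Submodule.starProjection_apply_mem _ _)
  rw [h1, norm_sub_sq_real, h3, EuclideanSpace.real_norm_sq_eq u]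
  simp [hu]

end Noise

/-! ### The risk of the least squares fit -/

section Estimation

variable {k m : Type*} [Fintype k] [Fintype m]

/-- The mean estimation error of the selected coefficients `v`, split into bias and variance. -/
lemma lintegral_estimation_error (v : EuclideanSpace ℝ m) {s : ℝ} (hs : 0 ≤ s) :
    ∫⁻ q : (k → EuclideanSpace ℝ m) × (k → ℝ), ENNReal.ofReal
        (‖v - WithLp.toLp 2 (pinv (rowMatrix q.1) *ᵥ (rowMatrix q.1 *ᵥ v + q.2))‖ ^ 2 + s)
        ∂(Measure.pi fun _ => stdGaussian (EuclideanSpace ℝ m)).prod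
          (Measure.pi fun _ => gaussianReal 0 s.toNNReal) =
      ∫⁻ a, ENNReal.ofReal (‖bias a v‖ ^ 2)
          ∂Measure.pi (fun _ : k => stdGaussian (EuclideanSpace ℝ m)) +
        ENNReal.ofReal s *
          (1 + ∫⁻ a, ENNReal.ofReal (∑ j, ∑ l, pinv (rowMatrix a) l j ^ 2)
            ∂Measure.pi (fun _ : k => stdGaussian (EuclideanSpace ℝ m))) := by
  set μ := Measure.pi (fun _ : k => stdGaussian (EuclideanSpace ℝ m)) with hμ
  set ν := Measure.pi (fun _ : k => gaussianReal 0 s.toNNReal) with hν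
  have hη : ∀ a : k → EuclideanSpace ℝ m, ∀ l, Measurable fun η : k → ℝ =>
      (pinv (rowMatrix a) *ᵥ η) l := fun a l => by
    simp only [Matrix.mulVec, dotProduct]
    fun_prop
  have hbias := aemeasurable_norm_sq_bias (k := k) v
  rw [← hμ] at hbias
  have hfrob : AEMeasurable
      (fun a => ENNReal.ofReal (∑ j, ∑ l, pinv (rowMatrix a) l j ^ 2)) μ :=
    (Finset.univ.aemeasurable_fun_sum fun j _ => Finset.univ.aemeasurable_fun_sum fun l _ =>
      (aemeasurable_pinv_rowMatrix l j).pow_const 2).ennreal_ofReal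
  have hnoise : AEMeasurable (fun q : (k → EuclideanSpace ℝ m) × (k → ℝ) =>
      ENNReal.ofReal (∑ l, (pinv (rowMatrix q.1) *ᵥ q.2) l ^ 2)) (μ.prod ν) := by
    refine (Finset.univ.aemeasurable_fun_sum fun l _ => AEMeasurable.pow_const ?_ 2).ennreal_ofReal
    simp only [Matrix.mulVec, dotProduct]
    refine Finset.univ.aemeasurable_fun_sum fun j _ => AEMeasurable.mul ?_
      (Measurable.aemeasurable (by fun_prop))
    exact (aemeasurable_pinv_rowMatrix l j).comp_quasiMeasurePreserving
      Measure.quasiMeasurePreserving_fst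
  have h1 : ∀ q : (k → EuclideanSpace ℝ m) × (k → ℝ), ENNReal.ofReal
      (‖v - WithLp.toLp 2 (pinv (rowMatrix q.1) *ᵥ (rowMatrix q.1 *ᵥ v + q.2))‖ ^ 2 + s) =
      ENNReal.ofReal (‖bias q.1 v‖ ^ 2) +
        ENNReal.ofReal (∑ l, (pinv (rowMatrix q.1) *ᵥ q.2) l ^ 2) + ENNReal.ofReal s := by
    intro q
    have h0 : 0 ≤ ∑ l, (pinv (rowMatrix q.1) *ᵥ q.2) l ^ 2 :=
      Finset.sum_nonneg fun l _ => sq_nonneg _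
    rw [norm_sq_sub_pinv_mulVec, ENNReal.ofReal_add (by positivity) hs,
      ENNReal.ofReal_add (by positivity) h0]
  have hbias' : AEMeasurable (fun q : (k → EuclideanSpace ℝ m) × (k → ℝ) =>
      ENNReal.ofReal (‖bias q.1 v‖ ^ 2)) (μ.prod ν) :=
    hbias.comp_quasiMeasurePreserving Measure.quasiMeasurePreserving_fst
  simp_rw [h1]
  rw [lintegral_add_right _ measurable_const, lintegral_add_left' hbias', lintegral_prod _ hbias',
    lintegral_prod _ hnoise]
  simp only [lintegral_const, measure_univ, mul_one, hν, lintegral_norm_sq_mulVec_gaussian]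
  rw [lintegral_const_mul'' _ hfrob, mul_add, mul_one, add_assoc, add_comm (ENNReal.ofReal s)]
  rfl

end Estimation

section Risk

variable {Ω : Type*} [MeasurableSpace Ω] {P : Measure Ω} [IsProbabilityMeasure P]
  {n D : ℕ} {β : EuclideanSpace ℝ (Fin D)} {σ : ℝ} (T : Finset (Fin D))
  {x : Ω → EuclideanSpace ℝ (Fin D)} {ε y : Ω → ℝ}
  {X : Fin n → Ω → EuclideanSpace ℝ (Fin D)} {Y : Fin n → Ω → ℝ}

lemma map_data_eq (hx : HasLaw x (stdGaussian (EuclideanSpace ℝ (Fin D))) P)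
    (hε : HasLaw ε (gaussianReal 0 1) P) (hxε : IndepFun x ε P)
    (hy : ∀ ω, y ω = inner ℝ (x ω) β + σ * ε ω) :
    P.map (fun ω => (x ω, y ω)) =
      ((stdGaussian (EuclideanSpace ℝ (Fin D))).prod (gaussianReal 0 1)).map
        (fun q => (q.1, inner ℝ q.1 β + σ * q.2)) := by
  have h := (indepFun_iff_map_prod_eq_prod_map_map hx.aemeasurable hε.aemeasurable).1 hxε
  rw [hx.map_eq, hε.map_eq] at h
  rw [← h, AEMeasurable.map_map_of_aemeasurable (Measurable.aemeasurable (by fun_prop))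
    (hx.aemeasurable.prodMk hε.aemeasurable)]
  congr 1
  funext ω
  simp [hy]

/-- The design matrix and the noise vector seen by the least squares fit of `β_T` are independent
and Gaussian. -/
lemma measurePreserving_sample {μ : Measure (EuclideanSpace ℝ (Fin D) × ℝ)}
    (hμ : μ = ((stdGaussian (EuclideanSpace ℝ (Fin D))).prod (gaussianReal 0 1)).map
      (fun q => (q.1, inner ℝ q.1 β + σ * q.2))) :
    MeasurePreserving (fun S : Fin n → EuclideanSpace ℝ (Fin D) × ℝ =>
        ((fun i => subvec T (S i).1),
          (fun i => (S i).2 - inner ℝ (subvec T (S i).1) (subvec T β))))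
      (Measure.pi fun _ => μ)
      ((Measure.pi fun _ => stdGaussian (EuclideanSpace ℝ T)).prod
        (Measure.pi fun _ => gaussianReal 0 (‖subvec Tᶜ β‖ ^ 2 + σ ^ 2).toNNReal)) := by
  have hc := continuous_subvec T
  have hg : Measurable fun q : EuclideanSpace ℝ (Fin D) × ℝ =>
      (subvec T q.1, q.2 - inner ℝ (subvec T q.1) (subvec T β)) :=
    Continuous.measurable (by fun_prop)
  have hmap : μ.map (fun q => (subvec T q.1, q.2 - inner ℝ (subvec T q.1) (subvec T β))) =
      (stdGaussian (EuclideanSpace ℝ T)).prod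
        (gaussianReal 0 (‖subvec Tᶜ β‖ ^ 2 + σ ^ 2).toNNReal) := by
    rw [hμ, Measure.map_map hg (by fun_prop), ← map_subvec_noise]
    congr 1
    funext q
    simp only [Function.comp_apply]
    rw [inner_eq_inner_subvec_add T q.1 β]
    congr 1
    ring
  have hμp : IsProbabilityMeasure μ := by
    rw [hμ]
    exact Measure.isProbabilityMeasure_map (Measurable.aemeasurable (by fun_prop))
  have h1 : MeasurePreserving (fun (S : Fin n → EuclideanSpace ℝ (Fin D) × ℝ) i =>
      (subvec T (S i).1, (S i).2 - inner ℝ (subvec T (S i).1) (subvec T β)))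
      (Measure.pi fun _ => μ) (Measure.pi fun _ => (stdGaussian (EuclideanSpace ℝ T)).prod
        (gaussianReal 0 (‖subvec Tᶜ β‖ ^ 2 + σ ^ 2).toNNReal)) := by
    refine ⟨measurable_pi_lambda _ fun i => hg.comp (measurable_pi_apply i), ?_⟩
    have hp : ∀ _ : Fin n, IsProbabilityMeasure
        (μ.map fun q => (subvec T q.1, q.2 - inner ℝ (subvec T q.1) (subvec T β))) := fun _ =>
      Measure.isProbabilityMeasure_map hg.aemeasurable
    rw [Measure.pi_map_pi (μ := fun _ : Fin n => μ) (f := fun _ : Fin n =>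
      fun q : EuclideanSpace ℝ (Fin D) × ℝ =>
        (subvec T q.1, q.2 - inner ℝ (subvec T q.1) (subvec T β))) fun _ => hg.aemeasurable]
    simp_rw [hmap]
  exact (measurePreserving_arrowProdEquivProdArrow _ _ (Fin n)
    (fun _ => stdGaussian (EuclideanSpace ℝ T))
    (fun _ => gaussianReal 0 (‖subvec Tᶜ β‖ ^ 2 + σ ^ 2).toNNReal)).comp h1

lemma norm_sq_sub_fit (X : Fin n → EuclideanSpace ℝ (Fin D)) (y : Fin n → ℝ) :
    ‖β - fit T X y‖ ^ 2 =
      ‖subvec T β - WithLp.toLp 2 (pinv (rowMatrix fun i => subvec T (X i)) *ᵥ y)‖ ^ 2 +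
        ‖subvec Tᶜ β‖ ^ 2 := by
  rw [norm_sq_eq_norm_sq_subvec_add T]
  congr 3
  · ext j
    simp [subvec, fit]
    rfl
  · ext j
    have hj : (j : Fin D) ∉ T := Finset.mem_compl.1 j.2
    simp [subvec, fit, hj]

/-- The risk as bias plus variance plus the error at the fresh data point. As `Y i` is tied to `X i`
only through the law of the pair `(X i, Y i)`, everything is computed from the joint law. -/
lemma risk_eq (hx : HasLaw x (stdGaussian (EuclideanSpace ℝ (Fin D))) P)
    (hε : HasLaw ε (gaussianReal 0 1) P) (hxε : IndepFun x ε P)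
    (hy : ∀ ω, y ω = inner ℝ (x ω) β + σ * ε ω)
    (hcopy : ∀ i, IdentDistrib (fun ω => (X i ω, Y i ω)) (fun ω => (x ω, y ω)) P P)
    (hiid : iIndepFun (fun i ω => (X i ω, Y i ω)) P)
    (hnew : IndepFun (fun ω => (x ω, y ω)) (fun ω i => (X i ω, Y i ω)) P) :
    risk P T x y X Y =
      ∫⁻ a, ENNReal.ofReal (‖bias a (subvec T β)‖ ^ 2)
          ∂Measure.pi (fun _ : Fin n => stdGaussian (EuclideanSpace ℝ T)) +
        ENNReal.ofReal (‖subvec Tᶜ β‖ ^ 2 + σ ^ 2) *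
          (1 + ∫⁻ a, ENNReal.ofReal (∑ j, ∑ l, pinv (rowMatrix a) l j ^ 2)
            ∂Measure.pi (fun _ : Fin n => stdGaussian (EuclideanSpace ℝ T))) := by
  set μ := P.map (fun ω => (x ω, y ω)) with hμdef
  have hμ := map_data_eq hx hε hxε hy
  rw [← hμdef] at hμ
  have hdata : AEMeasurable (fun ω => (x ω, y ω)) P := by
    simp_rw [hy]
    exact hx.aemeasurable.prodMk
      ((hx.aemeasurable.inner aemeasurable_const).add (hε.aemeasurable.const_mul σ))
  have hμp : IsProbabilityMeasure μ := Measure.isProbabilityMeasure_map hdata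
  have hsample : AEMeasurable (fun ω i => (X i ω, Y i ω)) P :=
    aemeasurable_pi_lambda _ fun i => (hcopy i).aemeasurable_fst
  have hlaw : P.map (fun ω i => (X i ω, Y i ω)) = Measure.pi fun _ : Fin n => μ := by
    rw [hiid.map_fun_eq_pi_map fun i => (hcopy i).aemeasurable_fst]
    congr 1
    funext i
    exact (hcopy i).map_eq
  have hjoint := (indepFun_iff_map_prod_eq_prod_map_map hdata hsample).1 hnew
  rw [hlaw, ← hμdef] at hjoint
  have hΨ := measurePreserving_sample (n := n) T hμ
  have hfit : AEMeasurable (fun S : Fin n → EuclideanSpace ℝ (Fin D) × ℝ =>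
      fit T (fun i => (S i).1) (fun i => (S i).2)) (Measure.pi fun _ => μ) := by
    unfold fit
    refine Measurable.comp_aemeasurable (by fun_prop)
      (aemeasurable_pi_lambda _ fun j => ?_)
    by_cases hj : j ∈ T
    · simp only [hj, dite_true, Matrix.mulVec, dotProduct]
      refine Finset.univ.aemeasurable_fun_sum fun i _ => AEMeasurable.mul ?_
        (Measurable.aemeasurable (by fun_prop))
      exact (aemeasurable_pinv_rowMatrix (k := Fin n) (m := T) ⟨j, hj⟩
        i).comp_quasiMeasurePreserving
        (Measure.quasiMeasurePreserving_fst.comp hΨ.quasiMeasurePreserving)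
    · simp only [hj, dite_false]
      exact aemeasurable_const
  have hΦ : AEMeasurable
      (fun q : (EuclideanSpace ℝ (Fin D) × ℝ) × (Fin n → EuclideanSpace ℝ (Fin D) × ℝ) =>
        ENNReal.ofReal ((q.1.2 - inner ℝ q.1.1
          (fit T (fun i => (q.2 i).1) (fun i => (q.2 i).2))) ^ 2))
      (μ.prod (Measure.pi fun _ => μ)) := by
    refine AEMeasurable.ennreal_ofReal (AEMeasurable.pow_const (AEMeasurable.sub
      (Measurable.aemeasurable (by fun_prop)) (AEMeasurable.inner
        (Measurable.aemeasurable (by fun_prop)) ?_)) 2)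
    exact hfit.comp_quasiMeasurePreserving Measure.quasiMeasurePreserving_snd
  have hΦ' := hΦ
  rw [← hjoint] at hΦ'
  have h1 : risk P T x y X Y = ∫⁻ q, ENNReal.ofReal ((q.1.2 - inner ℝ q.1.1
      (fit T (fun i => (q.2 i).1) (fun i => (q.2 i).2))) ^ 2)
      ∂μ.prod (Measure.pi fun _ : Fin n => μ) := by
    rw [← hjoint, lintegral_map' hΦ' (hdata.prodMk hsample)]
    rfl
  rw [h1, lintegral_prod_symm _ hΦ]
  have h2 : ∀ b : EuclideanSpace ℝ (Fin D), ∫⁻ q, ENNReal.ofReal ((q.2 - inner ℝ q.1 b) ^ 2) ∂μ =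
      ENNReal.ofReal (‖β - b‖ ^ 2 + σ ^ 2) := by
    intro b
    rw [hμ, lintegral_map (by fun_prop) (by fun_prop), lintegral_sq_sub_inner]
  simp_rw [h2]
  rw [← lintegral_estimation_error (subvec T β) (by positivity), ← hΨ.map_eq, lintegral_map' ?_
    hΨ.measurable.aemeasurable]
  · refine lintegral_congr fun S => ?_
    have hY : (rowMatrix fun i => subvec T (S i).1) *ᵥ (subvec T β) +
        (fun i => (S i).2 - inner ℝ (subvec T (S i).1) (subvec T β)) = fun i => (S i).2 := by
      funext i
      simp [rowMatrix_mulVec]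
    rw [norm_sq_sub_fit T, add_assoc, hY]
  · rw [hΨ.map_eq]
    refine ((AEMeasurable.pow_const (AEMeasurable.norm (aemeasurable_const.sub
      (Measurable.comp_aemeasurable (by fun_prop) (aemeasurable_pi_lambda _ fun l => ?_)))) 2).add
      aemeasurable_const).ennreal_ofReal
    simp only [Matrix.mulVec, dotProduct]
    refine Finset.univ.aemeasurable_fun_sum fun j _ => AEMeasurable.mul ?_ ?_
    · exact (aemeasurable_pinv_rowMatrix l j).comp_quasiMeasurePreserving
        Measure.quasiMeasurePreserving_fst
    · simp only [Pi.add_apply, rowMatrix]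
      exact Measurable.aemeasurable (by fun_prop)

end Risk

end DoubleDescent

theorem theorem2 {Ω : Type*} [MeasurableSpace Ω] (P : Measure Ω) [IsProbabilityMeasure P]
    (n D p : ℕ) (β : EuclideanSpace ℝ (Fin D)) (σ : ℝ) (hσ : 0 < σ)
    (T : Finset (Fin D)) (hT : T.card = p)
    -- the model `y = xᵀβ + σε`
    (x : Ω → EuclideanSpace ℝ (Fin D)) (ε y : Ω → ℝ)
    (hx : HasLaw x (stdGaussian (EuclideanSpace ℝ (Fin D))) P)
    (hε : HasLaw ε (gaussianReal 0 1) P)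
    (hxε : IndepFun x ε P)
    (hy : ∀ ω, y ω = inner ℝ (x ω) β + σ * ε ω)
    -- the sample: `n` iid copies of `(x, y)`, independent of `(x, y)`
    (X : Fin n → Ω → EuclideanSpace ℝ (Fin D)) (Y : Fin n → Ω → ℝ)
    (hcopy : ∀ i, IdentDistrib (fun ω => (X i ω, Y i ω)) (fun ω => (x ω, y ω)) P P)
    (hiid : iIndepFun (fun i ω => (X i ω, Y i ω)) P)
    (hnew : IndepFun (fun ω => (x ω, y ω)) (fun ω i => (X i ω, Y i ω)) P) :
    (p + 2 ≤ n →
      DoubleDescent.risk P T x y X Y =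
        ENNReal.ofReal ((‖DoubleDescent.subvec Tᶜ β‖ ^ 2 + σ ^ 2) *
          (1 + (p : ℝ) / ((n : ℝ) - 1 - p)))) ∧
    (1 ≤ n → 1 ≤ p → n ≤ p + 1 → p ≤ n + 1 →
      DoubleDescent.risk P T x y X Y = ⊤) ∧
    (n + 2 ≤ p →
      DoubleDescent.risk P T x y X Y =
        ENNReal.ofReal (‖DoubleDescent.subvec T β‖ ^ 2 * (1 - (n : ℝ) / p) +
          (‖DoubleDescent.subvec Tᶜ β‖ ^ 2 + σ ^ 2) *
            (1 + (n : ℝ) / ((p : ℝ) - n - 1)))) := by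
  have hrisk := DoubleDescent.risk_eq T hx hε hxε hy hcopy hiid hnew
  have hcT : Fintype.card T = p := by rw [Fintype.card_coe, hT]
  have hs : 0 < ‖DoubleDescent.subvec Tᶜ β‖ ^ 2 + σ ^ 2 := by positivity
  -- the variance term, for a design matrix that is wide, respectively tall
  have hwide (h : n ≤ p) := DoubleDescent.lintegral_frobenius_pinv_of_card_le
    (k := Fin n) (m := T) (by simpa [hT] using h)
  have htall (h : p ≤ n) := DoubleDescent.lintegral_frobenius_pinv_of_card_ge
    (k := Fin n) (m := T) (by simpa [hT] using h)
  rw [hcT, Fintype.card_fin] at hwide htall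
  refine ⟨fun h => ?_, fun hn hp h1 h2 => ?_, fun h => ?_⟩
  · have hd : (0 : ℝ) < n - 1 - p := by
      have : ((p + 2 : ℕ) : ℝ) ≤ n := by exact_mod_cast h
      push_cast at this
      linarith
    -- the subtraction in `ℕ` is exact here because `p ≤ n`
    have hcast : (((n - p + 1 : ℕ) : ℝ) - 2) = n - 1 - p := by
      push_cast [Nat.cast_sub (by omega : p ≤ n)]
      ring
    rw [hrisk, htall (by omega), DoubleDescent.lintegral_norm_sq_bias_eq_zero
      (by simp [hT]; omega), DoubleDescent.invChiSqMean, if_pos (by omega), hcast, zero_add,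
      ← ENNReal.ofReal_natCast, ← ENNReal.ofReal_mul (by positivity), ← ENNReal.ofReal_one,
      ← ENNReal.ofReal_add zero_le_one (by positivity), ← ENNReal.ofReal_mul hs.le, mul_one_div]
  · have htop : ∫⁻ a, ENNReal.ofReal (∑ j, ∑ l, DoubleDescent.pinv
        (DoubleDescent.rowMatrix a) l j ^ 2)
        ∂Measure.pi (fun _ : Fin n => stdGaussian (EuclideanSpace ℝ T)) = ⊤ := by
      rcases le_total n p with h | h
      · rw [hwide h, DoubleDescent.invChiSqMean, if_neg (by omega),
          ENNReal.mul_top (by simpa using by omega)]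
      · rw [htall h, DoubleDescent.invChiSqMean, if_neg (by omega),
          ENNReal.mul_top (by simpa using by omega)]
    rw [hrisk, htop, add_top, ENNReal.mul_top (by simpa using hs), add_top]
  · have hd : (0 : ℝ) < p - n - 1 := by
      have : ((n + 2 : ℕ) : ℝ) ≤ p := by exact_mod_cast h
      push_cast at this
      linarith
    -- the subtraction in `ℕ` is exact here because `n ≤ p`
    have hcast : (((p - n + 1 : ℕ) : ℝ) - 2) = p - n - 1 := by
      push_cast [Nat.cast_sub (by omega : n ≤ p)]
      ring
    have hfrac : (n : ℝ) / p ≤ 1 := by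
      rw [div_le_one (by exact_mod_cast (by omega : 0 < p))]
      exact_mod_cast (by omega : n ≤ p)
    rw [hrisk, hwide (by omega), DoubleDescent.lintegral_norm_sq_bias (by simp [hT]; omega), hcT,
      Fintype.card_fin, DoubleDescent.invChiSqMean, if_pos (by omega), hcast,
      ← ENNReal.ofReal_natCast, ← ENNReal.ofReal_mul (by positivity), ← ENNReal.ofReal_one,
      ← ENNReal.ofReal_add zero_le_one (by positivity), ← ENNReal.ofReal_mul hs.le,
      ← ENNReal.ofReal_add (mul_nonneg (sq_nonneg _) (by linarith)) (by positivity), mul_one_div]
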